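/- Let $\Sigma=\{1,2\}^{\mathbb Z}$ with the product topology, the left shift $(\sigma\omega)_n=\omega_{n+1}$ and the $(1/2,1/2)$-Bernoulli measure $\mu_\Sigma$. Let $X=\Sigma\times[-1,1]$, and let $\mu_X$ be the product of $\mu_\Sigma$ and the Lebesgue measure on $[-1,1]$. Let $f_1,f_2$ be orientation preserving $C^1$-diffeomorphisms of $[-1,1]$ onto their images such that: $f_i([-1,1])\subset(-1,1)$ for $i=1,2$; zero is the only fixed point of $f_1$; $f_1(0)=f_2(0)=0$, $f_1'(0)=1/2$, $f_2'(0)=2$; and for some $\varepsilon\in(0,1]$ both $f_1$ and $f_2$ are linear on $[-\varepsilon,\varepsilon]$. Let $F\colon X\to X$, $F(\omega,x)=(\sigma\omega,f_{\omega_0}(x))$, and $\Gamma=\{(\omega,x)\in X\mid x=0\}$. The maximal attractor is $A_{max}(F,X)=\bigcap_{n\ge1}F^n(X)$. The Milnor attractor $A_M(F)$ is the smallest closed set that contains the $\omega$-limit sets of $\mu_X$-almost all points. The statistical attractor $A_{stat}(F)$ is the smallest closed set that contains $\omega_{stat}(p)$ for $\mu_X$-almost all $p\in X$, where $\omega_{stat}(p)$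 is the set of points $z$ such that $\limsup_{N\to\infty}\frac1N\#\{0\le n<N: F^n(p)\in U\}>0$ for every neighborhood $U$ of $z$. A bony graph is a closed subset of $X$ that intersects $\mu_\Sigma$-almost every fiber $\{\omega\}\times[-1,1]$ in a single point and each remaining fiber in a non-degenerate segment; these segments are called bones. Then: 1. $A_{max}(F,X)$ is a bony graph; it is the union of $\Gamma$ and of its bones, and the union of its bones has $\mu_X$-measure zero. 2. $A_{stat}(F)$ exists and $A_{stat}(F)=\overline\Gamma=\Gamma$. 3. $A_M(F)$ exists and $A_M(F)\ne\overline\Gamma$. -/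

import Mathlib

open Set Filter Topology MeasureTheory

noncomputable section

namespace SSP

/-- The space of bi-infinite sequences of `s` symbols (product topology, product σ-algebra). -/
abbrev Seq (s : ℕ) : Type := ℤ → Fin s

/-- The Bernoulli shift `(σ ω) n = ω (n + 1)`. -/
def shift {s : ℕ} (ω : Seq s) : Seq s := fun n => ω (n + 1)

/-- The Bernoulli measure on sequences with `s` equiprobable symbols. -/
def bernoulliMeasure (s : ℕ) [NeZero s] : Measure (Seq s) :=
  Measure.infinitePi fun _ : ℤ => (PMF.uniformOfFintype (Fin s)).toMeasure

/-- The step skew product over the Bernoulli shift with fiber `M` and fiber maps `f i`. -/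
def stepSkewProduct {s : ℕ} {M : Type*} (f : Fin s → M → M) : Seq s × M → Seq s × M :=
  fun p => (shift p.1, f (p.1 0) p.2)

/-- The segment `[-1, 1]`. -/
abbrev Segment : Type := Icc (-1 : ℝ) 1

/-- Lebesgue measure on the segment `[-1, 1]`. -/
def segmentMeasure : Measure Segment := Measure.comap Subtype.val (volume : Measure ℝ)

/-- The product of the Bernoulli measure on the base and Lebesgue measure on the fiber `[-1, 1]`. -/
def phaseMeasure (s : ℕ) [NeZero s] : Measure (Seq s × Segment) :=
  (bernoulliMeasure s).prod segmentMeasure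

section Attractors

variable {X : Type*} [TopologicalSpace X]

/-- The ω-limit set of the positive semi-orbit of `x`. -/
def omegaLim (F : X → X) (x : X) : Set X :=
  omegaLimit atTop (fun (n : ℕ) (y : X) => F^[n] y) {x}

/-- The upper frequency with which the orbit of `x` visits `U`. -/
def freq (F : X → X) (x : X) (U : Set X) : ℝ :=
  limsup (fun N : ℕ => (1 / (N : ℝ)) * ({n : ℕ | n < N ∧ F^[n] x ∈ U}.ncard : ℝ)) atTop

/-- The statistical ω-limit set of `x`. -/
def omegaStat (F : X → X) (x : X) : Set X :=
  {z | ∀ U ∈ 𝓝 z, 0 < freq F x U}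

/-- `A` is the Milnor attractor: the smallest closed set that contains the ω-limit sets of
almost all points. -/
def IsMilnorAttractor [MeasurableSpace X] (F : X → X) (μ : Measure X) (A : Set X) : Prop :=
  IsLeast {K : Set X | IsClosed K ∧ ∀ᵐ x ∂μ, omegaLim F x ⊆ K} A

/-- `A` is the statistical attractor: the smallest closed set that contains the statistical
ω-limit sets of almost all points. -/
def IsStatisticalAttractor [MeasurableSpace X] (F : X → X) (μ : Measure X) (A : Set X) : Prop :=
  IsLeast {K : Set X | IsClosed K ∧ ∀ᵐ x ∂μ, omegaStat F x ⊆ K} A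

end Attractors

/-- The maximal attractor of `F` in `U`. -/
def maxAttractor {X : Type*} (F : X → X) (U : Set X) : Set X :=
  ⋂ n : ℕ, ⋂ _ : 1 ≤ n, F^[n] '' U

/-- The intersection of `K` with the fiber over `ω`, as a subset of the fiber. -/
def fiberOver {S M : Type*} (K : Set (S × M)) (ω : S) : Set M := {x | (ω, x) ∈ K}

/-- A closed set is a bony graph if it intersects almost every fiber by a single point and the
remaining fibers by non-degenerate segments. -/
def IsBonyGraph {S : Type*} [TopologicalSpace S] [MeasurableSpace S] (μ : Measure S)
    (K : Set (S × Segment)) : Prop :=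
  IsClosed K ∧
  (∀ᵐ ω ∂μ, ∃ x, fiberOver K ω = {x}) ∧
  ∀ ω, (¬ ∃ x, fiberOver K ω = {x}) → ∃ a b, a < b ∧ fiberOver K ω = Icc a b

/-- The union of the bones: the part of `K` over those `ω` where the fiber of `K` has more than
one point. -/
def bones {S M : Type*} (K : Set (S × M)) : Set (S × M) :=
  {p | p ∈ K ∧ (fiberOver K p.1).Nontrivial}

/-- The zero section `{(ω, x) | x = 0}`. -/
def zeroSection (s : ℕ) : Set (Seq s × Segment) := {p | (p.2 : ℝ) = 0}

end SSP

end

/-! The two halves of the fiber are invariant, so after reflecting the left one everything reduces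
to a pair of monotone maps of `[0, 1]` (`HalfSystem`). The fiber of the maximal attractor over `ω`
is the segment between the pullback limits of `-1` and `1`: start at time `-n`, look at time `0`,
let `n` grow.

The pullback limit depends only on the past of `ω` and is equivariant, so its law is stationary for
the random maps. Near the origin these maps halve or double, so on the dyadic shells `[ε/2^(k+1),
ε/2^k)` the stationary masses form a harmonic, hence affine, sequence. They are also summable, so
all of them vanish. Since `g 0` brings every positive point into `(0, ε)`, the law is the point mass
at `0` (`ae_pullbackLim_eq_zero`). Almost every fiber of the attractor is therefore a single point.

For the statistical attractor, the forward orbit at time `n` is dominated by a pullback of fixed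
depth `m` over the shifted sequence. The law of large numbers then bounds the frequency of being far
from `0` by a probability that tends to `0` with `m`. A typical base orbit visits every cylinder
with positive frequency, so the statistical limit set is the whole zero section.

The Milnor attractor is larger: while an orbit stays below `ε`, its logarithm is a simple random
walk, which is almost surely unbounded above. Hence positive orbits return above `ε` infinitely
often. -/

noncomputable section

namespace SSP

/-! ### The Bernoulli shift and the law of large numbers for finite-window functions -/

section Base

variable {s : ℕ}

/-- The `k`-th power of the shift, for an integer `k`. -/
def shiftBy (k : ℤ) (ω : Seq s) : Seq s := fun n => ω (n + k)

@[simp] lemma shiftBy_apply (k n : ℤ) (ω : Seq s) : shiftBy k ω n = ω (n + k) := rfl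

lemma measurable_shiftBy (k : ℤ) : Measurable (shiftBy k : Seq s → Seq s) := by
  unfold shiftBy; fun_prop

lemma dependsOn_comp_shiftBy {E : Type*} {Y : Seq s → E} {m : ℕ}
    (hY : DependsOn Y (Finset.Ico (-(m : ℤ)) m : Set ℤ)) (k : ℤ) :
    DependsOn (fun ω => Y (shiftBy k ω)) (Finset.Ico (k - m) (k + m) : Set ℤ) := by
  intro ω ω' h
  refine hY fun i hi => h _ ?_
  simp only [Finset.coe_Ico, mem_Ico] at hi ⊢
  constructor <;> linarith [hi.1, hi.2]

variable [NeZero s]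

instance : IsProbabilityMeasure (bernoulliMeasure s) := by
  unfold bernoulliMeasure; infer_instance

/-- All factors of the product measure are equal, so relabelling the indices preserves it. -/
lemma measurePreserving_shiftBy (k : ℤ) :
    MeasurePreserving (shiftBy k) (bernoulliMeasure s) (bernoulliMeasure s) := by
  refine ⟨measurable_shiftBy k, ?_⟩
  have h := Measure.infinitePi_map_piCongrLeft
    (fun _ : ℤ => (PMF.uniformOfFintype (Fin s)).toMeasure) (Equiv.addRight (-k))
  refine Eq.trans ?_ h
  unfold bernoulliMeasure
  congr 1
  ext ω i
  have := MeasurableEquiv.piCongrLeft_apply_apply (β := fun _ => Fin s) (Equiv.addRight (-k)) ω (i + k)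
  simp only [Equiv.coe_addRight, add_neg_cancel_right] at this
  simp [this]

lemma iIndepFun_coord :
    ProbabilityTheory.iIndepFun (fun (i : ℤ) (ω : Seq s) => ω i) (bernoulliMeasure s) :=
  ProbabilityTheory.iIndepFun_infinitePi
    (P := fun _ : ℤ => (PMF.uniformOfFintype (Fin s)).toMeasure) (X := fun _ x => x)
    (fun _ => measurable_id)

/-- A function of finitely many coordinates factors through the restriction to them. -/
lemma exists_factor_of_dependsOn {E : Type*} [MeasurableSpace E] {Y : Seq s → E} {S : Finset ℤ}
    (hY : DependsOn Y (S : Set ℤ)) :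
    ∃ y : (S → Fin s) → E, Measurable y ∧ Y = y ∘ fun ω i => ω i := by
  classical
  -- The value `0` outside `S` is arbitrary, since `Y` does not see those coordinates.
  refine ⟨fun v => Y fun i => if h : i ∈ S then v ⟨i, h⟩ else 0, .of_discrete, ?_⟩
  funext ω
  refine hY fun i hi => ?_
  simp [Finset.mem_coe.1 hi]

lemma measurable_of_dependsOn {E : Type*} [MeasurableSpace E] {Y : Seq s → E} {S : Finset ℤ}
    (hY : DependsOn Y (S : Set ℤ)) : Measurable Y := by
  obtain ⟨y, hy, rfl⟩ := exists_factor_of_dependsOn hY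
  exact hy.comp (by fun_prop)

lemma indepFun_of_dependsOn {E : Type*} [MeasurableSpace E] {Y Z : Seq s → E} {S T : Finset ℤ}
    (hY : DependsOn Y (S : Set ℤ)) (hZ : DependsOn Z (T : Set ℤ)) (hST : Disjoint S T) :
    ProbabilityTheory.IndepFun Y Z (bernoulliMeasure s) := by
  obtain ⟨y, hy, rfl⟩ := exists_factor_of_dependsOn hY
  obtain ⟨z, hz, rfl⟩ := exists_factor_of_dependsOn hZ
  exact (iIndepFun_coord.indepFun_finset S T hST fun i => measurable_pi_apply i).comp hy hz

lemma sum_mul_add (a : ℕ → ℝ) (L : ℕ) (J : ℕ) :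
    ∑ n ∈ Finset.range (J * L), a n
      = ∑ r ∈ Finset.range L, ∑ j ∈ Finset.range J, a (r + j * L) := by
  induction J with
  | zero => simp
  | succ J ih =>
    simp_rw [Finset.sum_range_succ, Finset.sum_add_distrib, ← ih]
    rw [add_mul, one_mul, Finset.sum_range_add]
    congr 1
    exact Finset.sum_congr rfl fun r _ => by rw [add_comm]

/-- Averages of a bounded sequence converge if they do along each residue class. -/
lemma tendsto_average_of_residues {a : ℕ → ℝ} {c : ℝ} {L : ℕ} (hL : 0 < L)
    (ha : ∀ n, |a n| ≤ 1)
    (h : ∀ r < L, Tendsto (fun J : ℕ => (∑ j ∈ Finset.range J, a (r + j * L)) / J) atTop (𝓝 c)) :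
    Tendsto (fun N : ℕ => (∑ n ∈ Finset.range N, a n) / N) atTop (𝓝 c) := by
  have hL' : (0 : ℝ) < L := by exact_mod_cast hL
  have hdiv : Tendsto (fun N : ℕ => N / L) atTop atTop := Nat.tendsto_div_const_atTop hL.ne'
  have h1 : Tendsto (fun J : ℕ => (∑ n ∈ Finset.range (J * L), a n) / J) atTop (𝓝 (L * c)) := by
    have := tendsto_finsetSum (Finset.range L) fun r hr => h r (Finset.mem_range.1 hr)
    simp only [Finset.sum_const, Finset.card_range, nsmul_eq_mul] at this
    refine this.congr fun J => ?_
    rw [sum_mul_add, Finset.sum_div]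
  have h2 : Tendsto (fun N : ℕ => ((N / L : ℕ) : ℝ) / N) atTop (𝓝 (1 / L)) := by
    have h3 := (tendsto_nat_floor_mul_div_atTop (R := ℝ) (a := 1 / L) (by positivity)).comp
      tendsto_natCast_atTop_atTop
    refine h3.congr fun N => ?_
    simp only [Function.comp]
    rw [one_div_mul_eq_div, Nat.floor_div_eq_div]
  have h4 : Tendsto (fun N : ℕ => (∑ n ∈ Finset.range (N / L * L), a n) / N) atTop (𝓝 c) := by
    have := (h1.comp hdiv).mul h2
    rw [show L * c * (1 / L) = c by field_simp] at this
    refine this.congr' ?_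
    filter_upwards [eventually_ge_atTop L] with N hN
    have : (0 : ℝ) < ((N / L : ℕ) : ℝ) := by exact_mod_cast Nat.div_pos hN hL
    simp only [Function.comp]
    field_simp
  -- Truncating `N` to a multiple of `L` drops fewer than `L` terms, each of size at most `1`.
  have h5 : Tendsto (fun N : ℕ => (∑ n ∈ Finset.range N, a n) / N
      - (∑ n ∈ Finset.range (N / L * L), a n) / N) atTop (𝓝 0) := by
    refine squeeze_zero_norm (a := fun N : ℕ => (L : ℝ) / N) (fun N => ?_)
      (tendsto_const_div_atTop_nhds_zero_nat _)
    rw [← sub_div, norm_div, Real.norm_natCast]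
    refine div_le_div_of_nonneg_right ?_ (by positivity)
    have hN := Finset.sum_range_add a (N / L * L) (N % L)
    rw [show N / L * L + N % L = N by rw [mul_comm]; exact Nat.div_add_mod N L] at hN
    rw [hN, add_sub_cancel_left]
    refine (norm_sum_le _ _).trans ((Finset.sum_le_sum fun i _ => ha _).trans ?_)
    simp only [Finset.sum_const, Finset.card_range, nsmul_eq_mul, mul_one]
    exact_mod_cast (Nat.mod_lt N hL).le
  simpa using h5.add h4

/-- The law of large numbers for the shifts of a function of finitely many coordinates. -/
theorem ae_tendsto_average_shift {Y : Seq s → ℝ} {m : ℕ}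
    (hY : DependsOn Y (Finset.Ico (-(m : ℤ)) m : Set ℤ)) (hb : ∀ ω, |Y ω| ≤ 1) :
    ∀ᵐ ω ∂bernoulliMeasure s,
      Tendsto (fun N : ℕ => (∑ n ∈ Finset.range N, Y (shiftBy n ω)) / N) atTop
        (𝓝 (∫ ω, Y ω ∂bernoulliMeasure s)) := by
  have hm : Measurable Y := measurable_of_dependsOn hY
  -- Shifts by different multiples of `2 * m + 1` read disjoint windows, so along a residue class
  -- the terms are pairwise independent and the strong law applies. The `+ 1` keeps the modulus
  -- positive when `m = 0`.
  have hres : ∀ r : ℕ, ∀ᵐ ω ∂bernoulliMeasure s,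
      Tendsto (fun J : ℕ => (∑ j ∈ Finset.range J, Y (shiftBy (r + j * (2 * m + 1) : ℕ) ω)) / J) atTop
        (𝓝 (∫ ω, Y ω ∂bernoulliMeasure s)) := by
    intro r
    have hid : ∀ k : ℤ, ProbabilityTheory.IdentDistrib (fun ω => Y (shiftBy k ω)) Y
        (bernoulliMeasure s) (bernoulliMeasure s) := fun k =>
      ⟨(hm.comp (measurable_shiftBy k)).aemeasurable, hm.aemeasurable, by
        change Measure.map (Y ∘ shiftBy k) _ = _
        rw [← Measure.map_map hm (measurable_shiftBy k), (measurePreserving_shiftBy k).map_eq]⟩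
    have hint : Integrable Y (bernoulliMeasure s) :=
      Integrable.of_bound hm.aestronglyMeasurable 1 (ae_of_all _ hb)
    have := ProbabilityTheory.strong_law_ae_real (μ := bernoulliMeasure s)
      (fun (j : ℕ) ω => Y (shiftBy (r + j * (2 * m + 1) : ℕ) ω))
      ((hid _).symm.integrable_snd hint) ?_ (fun i => (hid _).trans (hid _).symm)
    · rwa [(hid _).integral_eq] at this
    · intro i j hij
      refine indepFun_of_dependsOn (dependsOn_comp_shiftBy hY _) (dependsOn_comp_shiftBy hY _) ?_
      rw [Finset.disjoint_left]
      intro x hx hx'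
      simp only [Finset.mem_Ico] at hx hx'
      push_cast at hx hx'
      rcases lt_or_gt_of_ne hij with h | h
      · have : (i : ℤ) + 1 ≤ j := by exact_mod_cast h
        nlinarith
      · have : (j : ℤ) + 1 ≤ i := by exact_mod_cast h
        nlinarith
  filter_upwards [ae_all_iff.2 hres] with ω hω
  exact tendsto_average_of_residues (L := 2 * m + 1) (by omega) (fun n => hb _) fun r _ => hω r

end Base

/-! ### Conditioning on the zeroth symbol, and harmonic sequences -/

/-- Flipping the zeroth symbol. -/
def flipZero (ω : Seq 2) : Seq 2 := fun i => if i = 0 then Equiv.swap 0 1 (ω i) else ω i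

lemma measurePreserving_flipZero :
    MeasurePreserving flipZero (bernoulliMeasure 2) (bernoulliMeasure 2) := by
  have h := Measure.infinitePi_map_pi (fun _ : ℤ => (PMF.uniformOfFintype (Fin 2)).toMeasure)
    (f := fun i x => if i = 0 then Equiv.swap 0 1 x else x) (fun _ => .of_discrete)
  refine ⟨?_, ?_⟩
  · exact measurable_pi_iff.2 fun i =>
      (Measurable.of_discrete (f := fun x : Fin 2 => if i = 0 then Equiv.swap 0 1 x else x)).comp
        (measurable_pi_apply i)
  · refine h.trans ?_
    unfold bernoulliMeasure
    congr 1
    funext i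
    ext A hA
    rw [Measure.map_apply .of_discrete hA]
    classical
    split_ifs with hi
    · rw [PMF.toMeasure_uniformOfFintype_apply _ (MeasurableSet.of_discrete),
        PMF.toMeasure_uniformOfFintype_apply _ hA]
      congr 2
      exact Fintype.card_congr ((Equiv.swap 0 1).subtypeEquiv fun _ => Iff.rfl)
    · rfl

/-- An event that does not depend on the zeroth symbol is independent of it. -/
lemma measure_inter_zero_eq {A : Set (Seq 2)} (hA : MeasurableSet A) (h : flipZero ⁻¹' A = A)
    (i : Fin 2) :
    (bernoulliMeasure 2).real ({ω | ω 0 = i} ∩ A) = (bernoulliMeasure 2).real A / 2 := by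
  have hm : ∀ i : Fin 2, MeasurableSet {ω : Seq 2 | ω 0 = i} := fun i =>
    measurableSet_eq_fun (measurable_pi_apply 0) measurable_const
  have h1 : (bernoulliMeasure 2).real ({ω | ω 0 = 0} ∩ A)
      = (bernoulliMeasure 2).real ({ω | ω 0 = 1} ∩ A) := by
    rw [← measurePreserving_flipZero.measureReal_preimage ((hm 1).inter hA).nullMeasurableSet,
      preimage_inter, h]
    congr 2
    ext ω
    simp only [flipZero, mem_ofPred_eq, mem_preimage, if_true]
    generalize ω 0 = j
    fin_cases j <;> simp
  have h2 : (bernoulliMeasure 2).real A = (bernoulliMeasure 2).real ({ω | ω 0 = 0} ∩ A)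
      + (bernoulliMeasure 2).real ({ω | ω 0 = 1} ∩ A) := by
    rw [← measureReal_union _ ((hm 1).inter hA), ← union_inter_distrib_right]
    · congr 1
      ext ω
      simp only [mem_inter_iff, mem_union, mem_ofPred_eq]
      generalize ω 0 = j
      fin_cases j <;> simp
    · rw [Set.disjoint_left]
      rintro ω ⟨h0, -⟩ ⟨h1, -⟩
      simp_all
  fin_cases i <;> simp <;> linarith

/-- Conditioning on the zeroth symbol. -/
lemma measureReal_eq_half_add {A : Set (Seq 2)} {B : Fin 2 → Set (Seq 2)}
    (hB : ∀ i, MeasurableSet (B i)) (hflip : ∀ i, flipZero ⁻¹' B i = B i)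
    (h : ∀ ω, ω ∈ A ↔ ω ∈ B (ω 0)) :
    (bernoulliMeasure 2).real A
      = ((bernoulliMeasure 2).real (B 0) + (bernoulliMeasure 2).real (B 1)) / 2 := by
  have hA : A = ({ω | ω 0 = 0} ∩ B 0) ∪ ({ω | ω 0 = 1} ∩ B 1) := by
    ext ω
    rw [h]
    simp only [mem_union, mem_inter_iff, mem_ofPred_eq]
    generalize ω 0 = j
    fin_cases j <;> simp
  have hm : MeasurableSet {ω : Seq 2 | ω 0 = 1} :=
    measurableSet_eq_fun (measurable_pi_apply 0) measurable_const
  rw [hA, measureReal_union _ (hm.inter (hB 1)), measure_inter_zero_eq (hB 0) (hflip 0),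
    measure_inter_zero_eq (hB 1) (hflip 1)]
  · ring
  · rw [Set.disjoint_left]
    rintro ω ⟨h0, -⟩ ⟨h1, -⟩
    simp_all

lemma eq_add_mul_of_harmonic {u : ℕ → ℝ} (h : ∀ k, u (k + 1) = (u k + u (k + 2)) / 2) (k : ℕ) :
    u k = u 0 + k * (u 1 - u 0) ∧ u (k + 1) = u 0 + (k + 1) * (u 1 - u 0) := by
  induction k with
  | zero => simp
  | succ k ih =>
    refine ⟨by push_cast; exact ih.2, ?_⟩
    have := h k
    push_cast
    linarith [ih.1, ih.2]

/-- A harmonic sequence is affine; its constant increment must be the limit of `u (k + 1) - u k`,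
which is `0`. This is applied to the shell masses. -/
lemma eq_zero_of_harmonic_of_tendsto {u : ℕ → ℝ} (h : ∀ k, u (k + 1) = (u k + u (k + 2)) / 2)
    (hu : Tendsto u atTop (𝓝 0)) (k : ℕ) : u k = 0 := by
  have hd : u 1 - u 0 = 0 := by
    have h1 := (hu.comp (tendsto_add_atTop_nat 1)).sub hu
    simp only [sub_zero] at h1
    refine tendsto_nhds_unique (tendsto_const_nhds.congr fun k => ?_) h1
    simp only [Function.comp]
    linarith [(eq_add_mul_of_harmonic h k).1, (eq_add_mul_of_harmonic h k).2]
  have hc : ∀ k, u k = u 0 := fun k => by rw [(eq_add_mul_of_harmonic h k).1, hd]; ring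
  rw [hc]
  exact tendsto_nhds_unique (tendsto_const_nhds.congr fun k => (hc k).symm) hu

/-- An affine sequence with positive slope would exceed `1`. This is applied to the probabilities
that the walk stays below a barrier. -/
lemma eq_zero_of_harmonic_of_bounded {u : ℕ → ℝ} (h : ∀ k, u (k + 1) = (u k + u (k + 2)) / 2)
    (h0 : u 0 = 0) (hu : ∀ k, 0 ≤ u k) (hu1 : ∀ k, u k ≤ 1) (k : ℕ) : u k = 0 := by
  have hd : u 1 = 0 := by
    by_contra hne
    have hpos : 0 < u 1 := lt_of_le_of_ne (hu 1) (Ne.symm hne)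
    obtain ⟨n, hn⟩ := exists_nat_gt (1 / u 1)
    have h1 := (eq_add_mul_of_harmonic h n).1
    rw [h0] at h1
    rw [div_lt_iff₀ hpos] at hn
    linarith [hu1 n]
  rw [(eq_add_mul_of_harmonic h k).1, hd, h0]
  ring

/-! ### The simple random walk is unbounded above -/

section Walk

/-- The simple random walk driven by the symbols: `0` is a step down, `1` is a step up. -/
def walk (ω : Seq 2) (n : ℕ) : ℤ := ∑ j ∈ Finset.range n, ![-1, 1] (ω j)

lemma walk_succ_eq (ω : Seq 2) (n : ℕ) :
    walk ω (n + 1) = ![-1, 1] (ω 0) + walk (shiftBy 1 ω) n := by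
  simp [walk, Finset.sum_range_succ', add_comm _ (![-1, 1] (ω 0) : ℤ)]

lemma walk_succ (ω : Seq 2) (n : ℕ) :
    walk ω (n + 1) = walk ω n + ![-1, 1] (ω n) := Finset.sum_range_succ _ _

lemma measurable_walk (n : ℕ) : Measurable fun ω => walk ω n := by
  unfold walk
  refine Finset.measurable_sum _ fun j _ => ?_
  exact (Measurable.of_discrete (f := (![-1, 1] : Fin 2 → ℤ))).comp
    (measurable_pi_apply _)

lemma measurableSet_walk_lt (a : ℤ) : MeasurableSet {ω | ∀ n, walk ω n < a} := by
  rw [ofPred_forall]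
  exact MeasurableSet.iInter fun n => measurableSet_lt (measurable_walk n) measurable_const

/-- Conditioning on the first step makes the probability harmonic in the barrier `a`; it vanishes at
`a = 0` because the walk starts at `0`. -/
lemma measureReal_walk_lt (a : ℕ) : (bernoulliMeasure 2).real {ω | ∀ n, walk ω n < a} = 0 := by
  refine eq_zero_of_harmonic_of_bounded
    (u := fun a : ℕ => (bernoulliMeasure 2).real {ω | ∀ n, walk ω n < a}) (fun a => ?_) ?_
    (fun _ => measureReal_nonneg) (fun _ => measureReal_le_one) a
  · have hs := fun b : ℤ => (measurePreserving_shiftBy (s := 2) 1).measureReal_preimage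
      (measurableSet_walk_lt b).nullMeasurableSet
    -- Shift invariance turns the events on the right into events about the walk after its first
    -- step, which do not see the zeroth symbol. The barrier for the remaining walk is `a + 2` after
    -- a step down and `a` after a step up.
    rw [← hs, ← hs (a + 2 : ℕ), ← hs a, add_comm (Measure.real _ (shiftBy 1 ⁻¹' {ω | ∀ n, walk ω n < a})),
      hs (a + 1 : ℕ)]
    refine measureReal_eq_half_add (B := ![shiftBy 1 ⁻¹' {ω | ∀ n, walk ω n < (a + 2 : ℕ)},
      shiftBy 1 ⁻¹' {ω | ∀ n, walk ω n < a}]) (fun i => ?_) (fun i => ?_) (fun ω => ?_)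
    · fin_cases i
      · exact measurable_shiftBy 1 (measurableSet_walk_lt _)
      · exact measurable_shiftBy 1 (measurableSet_walk_lt _)
    · have : ∀ ω, walk (shiftBy 1 (flipZero ω)) = walk (shiftBy 1 ω) := by
        intro ω
        funext n
        refine Finset.sum_congr rfl fun j _ => ?_
        have : (j : ℤ) + 1 ≠ 0 := by positivity
        simp [flipZero, this]
      fin_cases i <;> ext ω <;> simp [this]
    -- The condition at time `0` is automatic because the barrier `a + 1` is positive.
    · have : (∀ n, walk ω n < (a + 1 : ℕ)) ↔ ∀ n, walk ω (n + 1) < (a + 1 : ℕ) := by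
        refine ⟨fun h n => h _, fun h n => ?_⟩
        cases n with
        | zero => simp [walk]
        | succ n => exact h n
      simp only [mem_ofPred_eq, this, walk_succ_eq]
      generalize ω 0 = j
      fin_cases j
      · simp only [Fin.zero_eta, Matrix.cons_val_zero, mem_preimage, mem_ofPred_eq]
        refine forall_congr' fun n => ?_
        push_cast
        constructor <;> intro h <;> linarith
      · simp only [Fin.mk_one, Matrix.cons_val_one]
        refine forall_congr' fun n => ?_
        push_cast
        constructor <;> intro h <;> linarith
  · have : {ω : Seq 2 | ∀ n, walk ω n < ((0 : ℕ) : ℤ)} = ∅ := by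
      ext ω
      simp only [mem_ofPred_eq, mem_empty_iff_false, iff_false, not_forall, not_lt]
      exact ⟨0, by simp [walk]⟩
    simp only [this, measureReal_empty]

/-- Almost surely, the walk restarted at any moment is unbounded from above. -/
lemma ae_walk_unbounded :
    ∀ᵐ ω ∂bernoulliMeasure 2, ∀ N a : ℕ, ∃ n, (a : ℤ) ≤ walk (shiftBy N ω) n := by
  refine ae_all_iff.2 fun N => ae_all_iff.2 fun a => ?_
  have h : ∀ᵐ ω ∂bernoulliMeasure 2, ∃ n, (a : ℤ) ≤ walk ω n := by
    rw [ae_iff]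
    have := measureReal_walk_lt a
    rw [measureReal_eq_zero_iff] at this
    simpa using this
  exact (measurePreserving_shiftBy N).quasiMeasurePreserving.ae h

end Walk

/-! ### Nonautonomous fiber orbits and pullback limits -/

section Orbit

variable {M : Type*} (g : Fin 2 → M → M)

/-- The state at time `m + n` of the nonautonomous orbit driven by `ω` that starts at time `m`
from `y`. -/
def orbit (ω : Seq 2) (y : M) (m : ℤ) : ℕ → M
  | 0 => y
  | n + 1 => g (ω (m + n)) (orbit ω y m n)

lemma orbit_shiftBy (k : ℤ) (ω : Seq 2) (y : M) (m : ℤ) (n : ℕ) :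
    orbit g (shiftBy k ω) y m n = orbit g ω y (m + k) n := by
  induction n with
  | zero => rfl
  | succ n ih => simp only [orbit, ih, shiftBy_apply]; rw [add_right_comm]

lemma orbit_add (ω : Seq 2) (y : M) (m : ℤ) (n k : ℕ) :
    orbit g ω y m (n + k) = orbit g ω (orbit g ω y m n) (m + n) k := by
  induction k with
  | zero => rfl
  | succ k ih => rw [← add_assoc]; simp only [orbit, ih]; push_cast; rw [add_assoc]

lemma orbit_congr {ω ω' : Seq 2} (y : M) (m : ℤ) (n : ℕ)
    (h : ∀ i, m ≤ i → i < m + n → ω i = ω' i) : orbit g ω y m n = orbit g ω' y m n := by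
  induction n with
  | zero => rfl
  | succ n ih =>
    simp only [orbit]
    rw [h _ (by omega) (by push_cast; omega), ih fun i h1 h2 => h i h1 (by push_cast; omega)]

lemma measurable_orbit [MeasurableSpace M] (y : M) (m : ℤ) (n : ℕ) : Measurable fun ω => orbit g ω y m n :=
  measurable_of_dependsOn (S := Finset.Ico m (m + n)) fun ω ω' h =>
    orbit_congr g y m n fun i h1 h2 => h i (by simp [h1, h2])

lemma iterate_stepSkewProduct (ω : Seq 2) (y : M) (n : ℕ) :
    (stepSkewProduct g)^[n] (ω, y) = (shiftBy n ω, orbit g ω y 0 n) := by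
  induction n with
  | zero => ext <;> simp [orbit]
  | succ n ih =>
    rw [Function.iterate_succ_apply', ih]
    ext1
    · ext i; simp [stepSkewProduct, shift, add_right_comm, ← add_assoc]
    · simp [stepSkewProduct, orbit]

end Orbit

/-- The pullback limit of the largest point of the segment. -/
def pullbackLim (g : Fin 2 → ℝ → ℝ) (ω : Seq 2) : ℝ := ⨅ n : ℕ, orbit g ω 1 (-n) n

lemma measurable_pullbackLim (g : Fin 2 → ℝ → ℝ) : Measurable (pullbackLim g) :=
  Measurable.iInf fun n => measurable_orbit g 1 (-n) n

/-- The pullback orbits use only the symbols at negative times; this gives the independence from `ω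
0` behind stationarity. -/
lemma pullbackLim_flipZero (g : Fin 2 → ℝ → ℝ) (ω : Seq 2) : pullbackLim g (flipZero ω) = pullbackLim g ω := by
  unfold pullbackLim
  congr 1
  funext n
  refine orbit_congr g 1 _ n fun i _ h2 => ?_
  have : i ≠ 0 := by omega
  simp [flipZero, this]

/-! ### The dynamics on one half of the fiber -/

/-- A pair of monotone maps of the real line that preserve `[0, 1]`, fix the origin, and are
multiplications by `1/2` and `2` near it from the right; the first one moves all of `(0, 1]`
towards the origin. -/
structure HalfSystem (g : Fin 2 → ℝ → ℝ) (ε : ℝ) : Prop where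
  eps_pos : 0 < ε
  eps_le : ε ≤ 1
  cont : ∀ i, Continuous (g i)
  mono : ∀ i, Monotone (g i)
  zero : ∀ i, g i 0 = 0
  le_one : ∀ i, g i 1 ≤ 1
  lt_self : ∀ x, 0 < x → x ≤ 1 → g 0 x < x
  lin0 : ∀ x, 0 ≤ x → x ≤ ε → g 0 x = x / 2
  lin1 : ∀ x, 0 ≤ x → x ≤ ε → g 1 x = 2 * x

namespace HalfSystem

variable {g : Fin 2 → ℝ → ℝ} {ε : ℝ} (hg : HalfSystem g ε)

include hg

lemma map_mem (i : Fin 2) {x : ℝ} (hx : x ∈ Icc (0 : ℝ) 1) : g i x ∈ Icc (0 : ℝ) 1 :=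
  ⟨(hg.zero i).symm.le.trans (hg.mono i hx.1), (hg.mono i hx.2).trans (hg.le_one i)⟩

lemma map_pos (i : Fin 2) {x : ℝ} (hx : 0 < x) : 0 < g i x := by
  have hm : 0 < min x ε := lt_min hx hg.eps_pos
  refine lt_of_lt_of_le ?_ (hg.mono i (min_le_left x ε))
  fin_cases i
  · simp only [Fin.zero_eta, hg.lin0 _ hm.le (min_le_right _ _)]; linarith
  · simp only [Fin.mk_one, hg.lin1 _ hm.le (min_le_right _ _)]; linarith

lemma orbit_mem (ω : Seq 2) {y : ℝ} (hy : y ∈ Icc (0 : ℝ) 1) (m : ℤ) (n : ℕ) :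
    orbit g ω y m n ∈ Icc (0 : ℝ) 1 := by
  induction n with
  | zero => exact hy
  | succ n ih => exact hg.map_mem _ ih

lemma orbit_pos (ω : Seq 2) {y : ℝ} (hy : 0 < y) (m : ℤ) (n : ℕ) : 0 < orbit g ω y m n := by
  induction n with
  | zero => exact hy
  | succ n ih => exact hg.map_pos _ ih

lemma orbit_mono (ω : Seq 2) (m : ℤ) (n : ℕ) : Monotone fun y => orbit g ω y m n := by
  induction n with
  | zero => exact monotone_id
  | succ n ih => exact (hg.mono _).comp ih

/-- Starting one step earlier replaces the initial point `1` by an image of `1`, which is at most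
`1`; monotonicity carries this to time `0`. -/
lemma antitone_pullback (ω : Seq 2) : Antitone fun n : ℕ => orbit g ω 1 (-n) n := by
  refine antitone_nat_of_succ_le fun n => ?_
  have h := orbit_add g ω 1 (-(n + 1 : ℕ)) 1 n
  rw [show -((n + 1 : ℕ) : ℤ) + (1 : ℕ) = -n by push_cast; ring] at h
  rw [add_comm n 1] at h ⊢
  rw [h]
  exact hg.orbit_mono _ _ _ (hg.orbit_mem ω (by simp) _ _).2

lemma tendsto_pullbackLim (ω : Seq 2) :
    Tendsto (fun n : ℕ => orbit g ω 1 (-n) n) atTop (𝓝 (pullbackLim g ω)) :=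
  tendsto_atTop_ciInf (hg.antitone_pullback ω)
    ⟨0, by rintro _ ⟨n, rfl⟩; exact (hg.orbit_mem ω (by simp) _ _).1⟩

lemma pullbackLim_mem (ω : Seq 2) : pullbackLim g ω ∈ Icc (0 : ℝ) 1 :=
  isClosed_Icc.mem_of_tendsto (hg.tendsto_pullbackLim ω)
    (Eventually.of_forall fun n => hg.orbit_mem ω (by simp) _ _)

lemma pullbackLim_shiftBy_one (ω : Seq 2) :
    pullbackLim g (shiftBy 1 ω) = g (ω 0) (pullbackLim g ω) := by
  have h1 := (hg.tendsto_pullbackLim (shiftBy 1 ω)).comp (tendsto_add_atTop_nat 1)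
  have h2 := ((hg.cont (ω 0)).tendsto _).comp (hg.tendsto_pullbackLim ω)
  refine tendsto_nhds_unique (h1.congr fun n => ?_) h2
  simp only [Function.comp]
  rw [orbit_shiftBy]
  simp [orbit]

/-- The law of the pullback limit is stationary. -/
lemma law_stationary {A : Set ℝ} (hA : MeasurableSet A) :
    (bernoulliMeasure 2).real {ω | pullbackLim g ω ∈ A}
      = ((bernoulliMeasure 2).real {ω | g 0 (pullbackLim g ω) ∈ A}
        + (bernoulliMeasure 2).real {ω | g 1 (pullbackLim g ω) ∈ A}) / 2 := by
  rw [← (measurePreserving_shiftBy (s := 2) 1).measureReal_preimage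
    (s := {ω | pullbackLim g ω ∈ A}) (measurable_pullbackLim g hA).nullMeasurableSet]
  refine measureReal_eq_half_add (B := fun i => {ω | g i (pullbackLim g ω) ∈ A}) (fun i => ?_)
    (fun i => ?_) (fun ω => ?_)
  · exact ((hg.cont i).measurable.comp (measurable_pullbackLim g)) hA
  · ext ω
    simp only [mem_preimage, mem_ofPred_eq, pullbackLim_flipZero]
  · simp only [mem_preimage, mem_ofPred_eq, hg.pullbackLim_shiftBy_one]

lemma map_zero_mem_iff {x : ℝ} (hx : 0 ≤ x) (k : ℕ) :
    g 0 x ∈ Ico (ε / 2 ^ (k + 2)) (ε / 2 ^ (k + 1)) ↔ x ∈ Ico (ε / 2 ^ (k + 1)) (ε / 2 ^ k) := by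
  have h1 : ε / 2 ^ (k + 1) = ε / 2 ^ k / 2 := by rw [pow_succ]; field_simp
  have h2 : ε / 2 ^ (k + 2) = ε / 2 ^ k / 4 := by rw [pow_add]; field_simp; norm_num
  have h3 : ε / 2 ^ k ≤ ε := div_le_self hg.eps_pos.le (one_le_pow₀ (by norm_num))
  rw [h1, h2]
  simp only [mem_Ico]
  rcases le_or_gt x ε with h | h
  · rw [hg.lin0 x hx h]
    constructor <;> rintro ⟨ha, hb⟩ <;> constructor <;> linarith
  -- Beyond `ε` both sides fail: by monotonicity `g 0 x` is at least `ε / 2`.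
  · have := hg.mono 0 h.le
    rw [hg.lin0 ε hg.eps_pos.le le_rfl] at this
    constructor <;> rintro ⟨ha, hb⟩ <;> linarith

lemma map_one_mem_iff {x : ℝ} (hx : 0 ≤ x) (k : ℕ) :
    g 1 x ∈ Ico (ε / 2 ^ (k + 2)) (ε / 2 ^ (k + 1))
      ↔ x ∈ Ico (ε / 2 ^ (k + 3)) (ε / 2 ^ (k + 2)) := by
  have h1 : ε / 2 ^ (k + 1) = ε / 2 ^ k / 2 := by rw [pow_succ]; field_simp
  have h2 : ε / 2 ^ (k + 2) = ε / 2 ^ k / 4 := by rw [pow_add]; field_simp; norm_num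
  have h4 : ε / 2 ^ (k + 3) = ε / 2 ^ k / 8 := by rw [pow_add]; field_simp; norm_num
  have h3 : ε / 2 ^ k ≤ ε := div_le_self hg.eps_pos.le (one_le_pow₀ (by norm_num))
  have h5 := hg.eps_pos
  rw [h1, h2, h4]
  simp only [mem_Ico]
  rcases le_or_gt x ε with h | h
  · rw [hg.lin1 x hx h]
    constructor <;> rintro ⟨ha, hb⟩ <;> constructor <;> linarith
  · have := hg.mono 1 h.le
    rw [hg.lin1 ε hg.eps_pos.le le_rfl] at this
    constructor <;> rintro ⟨ha, hb⟩ <;> linarith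

/-- Otherwise the iterates decrease to a fixed point of `g 0` in `[ε, 1]`. -/
lemma exists_iterate_lt {x : ℝ} (h1 : x ≤ 1) : ∃ n : ℕ, (g 0)^[n] x < ε := by
  by_contra! hc
  have hle : ∀ n, (g 0)^[n] x ≤ 1 := by
    intro n
    induction n with
    | zero => exact h1
    | succ n ih =>
      rw [Function.iterate_succ_apply']
      exact (hg.lt_self _ (hg.eps_pos.trans_le (hc n)) ih).le.trans ih
  have hanti : Antitone fun n => (g 0)^[n] x := antitone_nat_of_succ_le fun n => by
    rw [Function.iterate_succ_apply']
    exact (hg.lt_self _ (hg.eps_pos.trans_le (hc n)) (hle n)).le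
  have hlim := tendsto_atTop_ciInf hanti ⟨ε, by rintro _ ⟨n, rfl⟩; exact hc n⟩
  set l := ⨅ n, (g 0)^[n] x
  have hl : ε ≤ l := ge_of_tendsto' hlim hc
  have hl1 : l ≤ 1 := le_of_tendsto' hlim hle
  have hfix : g 0 l = l := by
    refine tendsto_nhds_unique (((hg.cont 0).tendsto l).comp hlim) ?_
    refine (hlim.comp (tendsto_add_atTop_nat 1)).congr fun n => ?_
    simp [Function.iterate_succ_apply']
  exact (hg.lt_self l (hg.eps_pos.trans_le hl) hl1).ne hfix

/-- By stationarity the mass of shell `k + 1` is the mean of the masses of its preimages, shell `k`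
under halving and shell `k + 2` under doubling. Disjointness makes the masses summable, so they tend
to `0`. -/
lemma measure_pullbackLim_shell (k : ℕ) :
    (bernoulliMeasure 2).real {ω | pullbackLim g ω ∈ Ico (ε / 2 ^ (k + 1)) (ε / 2 ^ k)} = 0 := by
  have hanti : ∀ i j : ℕ, i ≤ j → ε / 2 ^ j ≤ ε / 2 ^ i := fun i j hij =>
    div_le_div_of_nonneg_left hg.eps_pos.le (by positivity) (pow_le_pow_right₀ (by norm_num) hij)
  refine eq_zero_of_harmonic_of_tendsto (u := fun k : ℕ => (bernoulliMeasure 2).real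
    {ω | pullbackLim g ω ∈ Ico (ε / 2 ^ (k + 1)) (ε / 2 ^ k)}) (fun k => ?_) ?_ k
  · rw [hg.law_stationary measurableSet_Ico]
    simp only [add_assoc, Nat.reduceAdd]
    congr 3
    · ext ω
      exact hg.map_zero_mem_iff (hg.pullbackLim_mem ω).1 k
    · ext ω
      exact hg.map_one_mem_iff (hg.pullbackLim_mem ω).1 k
  · refine (summable_measure_toReal (μ := bernoulliMeasure 2)
      (fun k => measurable_pullbackLim g measurableSet_Ico) ?_).tendsto_atTop_zero
    intro i j hij
    refine Set.disjoint_left.2 fun ω (hi : _ ∧ _) (hj : _ ∧ _) => ?_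
    rcases lt_or_gt_of_ne hij with h | h
    · linarith [hanti (i + 1) j h, hi.1, hj.2]
    · linarith [hanti (j + 1) i h, hj.1, hi.2]

lemma measure_pullbackLim_small :
    (bernoulliMeasure 2).real {ω | pullbackLim g ω ∈ Ioo 0 ε} = 0 := by
  rw [measureReal_eq_zero_iff]
  refine measure_mono_null (t := ⋃ k : ℕ,
    {ω | pullbackLim g ω ∈ Ico (ε / 2 ^ (k + 1)) (ε / 2 ^ k)}) (fun ω hω => ?_)
    (measure_iUnion_null fun k => (measureReal_eq_zero_iff).1 (hg.measure_pullbackLim_shell k))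
  set x := pullbackLim g ω with hxdef
  obtain ⟨h0, h1⟩ : 0 < x ∧ x < ε := hω
  have hex : ∃ k : ℕ, ε / 2 ^ (k + 1) ≤ x := by
    obtain ⟨n, hn⟩ := pow_unbounded_of_one_lt (ε / x) (one_lt_two)
    refine ⟨n, ?_⟩
    rw [div_lt_iff₀ h0] at hn
    rw [div_le_iff₀ (by positivity), pow_succ]
    nlinarith [hg.eps_pos]
  -- Minimality of the index gives the upper end of the shell.
  refine mem_iUnion.2 ⟨Nat.find hex, Nat.find_spec hex, ?_⟩
  rcases h : Nat.find hex with _ | k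
  · simpa using h1
  · have := Nat.find_min hex (m := k) (by omega)
    exact not_le.1 this

/-- The pullback limit vanishes almost surely. -/
theorem ae_pullbackLim_eq_zero : ∀ᵐ ω ∂bernoulliMeasure 2, pullbackLim g ω = 0 := by
  have hn : ∀ n : ℕ, (bernoulliMeasure 2).real {ω | (g 0)^[n] (pullbackLim g ω) ∈ Ioo 0 ε} = 0 := by
    -- Stationarity gives the `g 0`-preimage of a set at most twice the mass of the set, so null
    -- sets pull back to null sets. The set must vary for the induction.
    suffices h : ∀ A : Set ℝ, MeasurableSet A →
        (bernoulliMeasure 2).real {ω | pullbackLim g ω ∈ A} = 0 →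
        ∀ n : ℕ, (bernoulliMeasure 2).real {ω | (g 0)^[n] (pullbackLim g ω) ∈ A} = 0 from
      h _ measurableSet_Ioo hg.measure_pullbackLim_small
    intro A hA h n
    induction n generalizing A with
    | zero => exact h
    | succ n ih =>
      have h1 := hg.law_stationary hA
      rw [h] at h1
      have h2 : (bernoulliMeasure 2).real {ω | g 0 (pullbackLim g ω) ∈ A} = 0 := by
        have := measureReal_nonneg (μ := bernoulliMeasure 2)
          (s := {ω | g 0 (pullbackLim g ω) ∈ A})
        have := measureReal_nonneg (μ := bernoulliMeasure 2)
          (s := {ω | g 1 (pullbackLim g ω) ∈ A})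
        linarith
      simp only [Function.iterate_succ_apply']
      exact ih (g 0 ⁻¹' A) ((hg.cont 0).measurable hA) h2
  rw [ae_iff]
  refine measure_mono_null (fun ω hω => ?_)
    (measure_iUnion_null fun n => (measureReal_eq_zero_iff).1 (hn n))
  have hmem := hg.pullbackLim_mem ω
  have hpos : 0 < pullbackLim g ω := lt_of_le_of_ne hmem.1 (Ne.symm hω)
  obtain ⟨n, hn⟩ := hg.exists_iterate_lt hmem.2
  refine mem_iUnion.2 ⟨n, ?_, hn⟩
  clear hn
  induction n with
  | zero => exact hpos
  | succ n ih => rw [Function.iterate_succ_apply']; exact hg.map_pos 0 ih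

/-- At time `n - m` the orbit is at most `1`; restarting from `1` there can only increase the final
value. The bound reads just `m` symbols. -/
lemma orbit_le_pullback (ω : Seq 2) {m n : ℕ} (h : m ≤ n) :
    orbit g ω 1 0 n ≤ orbit g (shiftBy n ω) 1 (-m) m := by
  obtain ⟨k, rfl⟩ := Nat.exists_eq_add_of_le' h
  rw [orbit_shiftBy, orbit_add]
  rw [show -(m : ℤ) + ((k + m : ℕ) : ℤ) = 0 + k by push_cast; ring]
  exact hg.orbit_mono _ _ _ (hg.orbit_mem ω (by simp) _ _).2

/-- Almost surely, the orbit of the largest point spends zero proportion of time away from the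
origin. -/
theorem ae_tendsto_frequency_zero {δ : ℝ} (hδ : 0 < δ) :
    ∀ᵐ ω ∂bernoulliMeasure 2, Tendsto (fun N : ℕ =>
      (∑ n ∈ Finset.range N, (Ici δ).indicator 1 (orbit g ω 1 0 n)) / (N : ℝ)) atTop (𝓝 0) := by
  set Y : ℕ → Seq 2 → ℝ := fun m ω => (Ici δ).indicator 1 (orbit g ω 1 (-m) m) with hYdef
  have hY0 : ∀ m ω, 0 ≤ Y m ω := fun m ω => indicator_nonneg (fun _ _ => zero_le_one) _
  have hY1 : ∀ m ω, Y m ω ≤ 1 := fun m ω => indicator_le_self' (fun _ _ => zero_le_one) _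
  have hYdep : ∀ m : ℕ, DependsOn (Y m) (Finset.Ico (-(m : ℤ)) m : Set ℤ) := by
    intro m ω ω' h
    simp only [hYdef]
    rw [orbit_congr g 1 _ m fun i h1 h2 => h i (by
      simp only [Finset.coe_Ico, mem_Ico]; omega)]
  have hlim : Tendsto (fun m => ∫ ω, Y m ω ∂bernoulliMeasure 2) atTop (𝓝 0) := by
    rw [← integral_zero (Seq 2) ℝ (μ := bernoulliMeasure 2)]
    refine tendsto_integral_of_dominated_convergence (fun _ => 1)
      (fun m => (measurable_of_dependsOn (hYdep m)).aestronglyMeasurable) (integrable_const _)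
      (fun m => ae_of_all _ fun ω => ?_) ?_
    · rw [Real.norm_of_nonneg (hY0 m ω)]; exact hY1 m ω
    · filter_upwards [hg.ae_pullbackLim_eq_zero] with ω hω
      have := hg.tendsto_pullbackLim ω
      rw [hω] at this
      refine tendsto_const_nhds.congr' ?_
      filter_upwards [this.eventually_lt_const hδ] with m hm
      simp only [hYdef]
      rw [indicator_of_notMem (by simpa using hm)]
  have hae : ∀ᵐ ω ∂bernoulliMeasure 2, ∀ m : ℕ, Tendsto (fun N : ℕ =>
      (∑ n ∈ Finset.range N, Y m (shiftBy n ω)) / N) atTop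
        (𝓝 (∫ ω, Y m ω ∂bernoulliMeasure 2)) :=
    ae_all_iff.2 fun m => ae_tendsto_average_shift (hYdep m) fun ω => by
      rw [abs_of_nonneg (hY0 m ω)]; exact hY1 m ω
  filter_upwards [hae] with ω hω
  refine tendsto_order.2 ⟨fun a ha => Eventually.of_forall fun N => ha.trans_le ?_, fun a ha => ?_⟩
  · exact div_nonneg (Finset.sum_nonneg fun n _ => indicator_nonneg (fun _ _ => zero_le_one) _)
      (by positivity)
  · obtain ⟨m, hm⟩ := (hlim.eventually_lt_const ha).exists
    have h1 := (tendsto_const_div_atTop_nhds_zero_nat (m : ℝ)).add (hω m)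
    rw [zero_add] at h1
    filter_upwards [h1.eventually_lt_const hm] with N hN
    refine lt_of_le_of_lt ?_ hN
    rw [← add_div]
    refine div_le_div_of_nonneg_right ?_ (by positivity)
    -- The depth-`m` comparison is available from time `m` on; the first `m` terms cost at most `m /
    -- N` in the average.
    have hle : ∀ n : ℕ, (Ici δ).indicator 1 (orbit g ω 1 0 n)
        ≤ (if n < m then (1 : ℝ) else 0) + Y m (shiftBy n ω) := by
      intro n
      split_ifs with h
      · have : (Ici δ).indicator (1 : ℝ → ℝ) (orbit g ω 1 0 n) ≤ 1 :=
          indicator_le_self' (fun _ _ => zero_le_one) _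
        linarith [hY0 m (shiftBy n ω)]
      · have h2 := hg.orbit_le_pullback ω (not_lt.1 h)
        simp only [hYdef, zero_add, indicator, mem_Ici, Pi.one_apply]
        split_ifs with h3 h4 h4
        · rfl
        · exact absurd (h3.trans h2) h4
        · exact zero_le_one
        · rfl
    refine (Finset.sum_le_sum fun n _ => hle n).trans ?_
    rw [Finset.sum_add_distrib]
    gcongr
    rw [← Finset.sum_filter, Finset.sum_const, nsmul_eq_mul, mul_one]
    refine Nat.cast_le.2 ((Finset.card_le_card (t := Finset.range m) fun n hn => ?_).trans
      (Finset.card_range m).le)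
    simpa using (Finset.mem_filter.1 hn).2

/-- Almost surely, no orbit of a positive point stays eventually close to the origin. -/
theorem ae_frequently_ge : ∀ᵐ ω ∂bernoulliMeasure 2, ∀ x : ℝ, 0 < x →
    ∃ᶠ n in atTop, ε ≤ orbit g ω x 0 n := by
  filter_upwards [ae_walk_unbounded] with ω hω x hx hc
  obtain ⟨N, hN⟩ := eventually_atTop.1 hc
  simp only [not_le] at hN
  have hpos := hg.orbit_pos ω hx 0
  -- If the orbit stays below `ε` after time `N`, only the linear branches act, so it is multiplied
  -- by `2` to the power of the walk, which is unbounded.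
  have hform : ∀ n : ℕ, orbit g ω x 0 (N + n)
      = orbit g ω x 0 N * (2 : ℝ) ^ walk (shiftBy N ω) n := by
    intro n
    induction n with
    | zero => simp [walk]
    | succ n ih =>
      have hlt := hN (N + n) (by omega)
      have hp := hpos (N + n)
      rw [← add_assoc, walk_succ, zpow_add₀ two_ne_zero, ← mul_assoc, ← ih]
      simp only [orbit, shiftBy_apply, zero_add, Nat.cast_add]
      rw [add_comm (n : ℤ)]
      generalize ω (N + n) = j
      fin_cases j
      · simp only [Fin.zero_eta, hg.lin0 _ hp.le hlt.le, Matrix.cons_val_zero, zpow_neg, zpow_one]; ring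
      · simp only [Fin.mk_one, hg.lin1 _ hp.le hlt.le, Matrix.cons_val_one, Matrix.cons_val_fin_one, zpow_one]; ring
  obtain ⟨a, ha⟩ := pow_unbounded_of_one_lt (ε / orbit g ω x 0 N) (one_lt_two)
  obtain ⟨n, hn⟩ := hω N a
  have h1 := hN (N + n) (by omega)
  rw [hform] at h1
  rw [div_lt_iff₀ (hpos N)] at ha
  have h2 : (2 : ℝ) ^ a ≤ 2 ^ walk (shiftBy N ω) n := by
    rw [← zpow_natCast]
    exact zpow_le_zpow_right₀ (by norm_num) hn
  nlinarith [hpos N]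

end HalfSystem

/-! ### Existence of smallest closed sets, and estimates of visit frequencies -/

section General

variable {X : Type*}

/-- In a second countable space there is a smallest closed set that contains almost all members
of a family of sets. -/
lemma exists_isLeast_isClosed_ae_subset [TopologicalSpace X] [SecondCountableTopology X] {Y : Type*}
    [MeasurableSpace Y] (μ : Measure Y) (L : Y → Set X) :
    ∃ A, IsLeast {K : Set X | IsClosed K ∧ ∀ᵐ x ∂μ, L x ⊆ K} A := by
  -- Remove every basic open set that almost all `L x` avoid; countability keeps the union of the
  -- exceptional sets null.
  set B := {U | U ∈ TopologicalSpace.countableBasis X ∧ ∀ᵐ x ∂μ, L x ⊆ Uᶜ}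
  have hB : B.Countable := (TopologicalSpace.countable_countableBasis X).mono fun U hU => hU.1
  refine ⟨⋂ U ∈ B, Uᶜ, ⟨?_, ?_⟩, ?_⟩
  · exact isClosed_biInter fun U hU =>
      ((TopologicalSpace.isBasis_countableBasis X).isOpen hU.1).isClosed_compl
  · filter_upwards [(ae_ball_iff hB).2 fun U hU => hU.2] with x hx
    exact subset_iInter₂ hx
  · rintro K ⟨hK, hKL⟩ y hy
    by_contra hyK
    obtain ⟨U, hU, hyU, hUK⟩ := (TopologicalSpace.isBasis_countableBasis X).exists_subset_of_mem_open
      (show y ∈ Kᶜ from hyK) hK.isOpen_compl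
    refine mem_iInter₂.1 hy U ⟨hU, ?_⟩ hyU
    filter_upwards [hKL] with x hx
    exact hx.trans (subset_compl_comm.1 hUK)

lemma visits_eq_sum (F : X → X) (x : X) (U : Set X) (N : ℕ) :
    (1 / (N : ℝ)) * ({n : ℕ | n < N ∧ F^[n] x ∈ U}.ncard : ℝ)
      = (∑ n ∈ Finset.range N, U.indicator 1 (F^[n] x)) / N := by
  classical
  have : {n : ℕ | n < N ∧ F^[n] x ∈ U} = (Finset.range N).filter fun n => F^[n] x ∈ U := by
    ext; simp
  rw [this, ncard_coe_finset, one_div_mul_eq_div, Finset.card_filter]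
  push_cast
  simp only [indicator, Pi.one_apply]

lemma freq_eq_zero {F : X → X} {x : X} {U : Set X} {a : ℕ → ℝ}
    (ha : ∀ n, U.indicator 1 (F^[n] x) ≤ a n)
    (h : Tendsto (fun N : ℕ => (∑ n ∈ Finset.range N, a n) / N) atTop (𝓝 0)) :
    freq F x U = 0 := by
  refine Tendsto.limsup_eq (squeeze_zero (fun N => by positivity) (fun N => ?_) h)
  rw [visits_eq_sum]
  exact div_le_div_of_nonneg_right (Finset.sum_le_sum fun n _ => ha n) (by positivity)

lemma le_freq {F : X → X} {x : X} {U : Set X} {a : ℕ → ℝ} {c : ℝ}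
    (ha : ∀ n, a n ≤ U.indicator 1 (F^[n] x))
    (h : Tendsto (fun N : ℕ => (∑ n ∈ Finset.range N, a n) / N) atTop (𝓝 c)) :
    c ≤ freq F x U := by
  rw [← h.limsup_eq]
  refine limsup_le_limsup (Eventually.of_forall fun N => ?_) h.isCoboundedUnder_le ?_
  · simp only [visits_eq_sum]
    exact div_le_div_of_nonneg_right (Finset.sum_le_sum fun n _ => ha n) (by positivity)
  · refine isBoundedUnder_of ⟨1, fun N => ?_⟩
    rw [visits_eq_sum]
    refine div_le_one_of_le₀ ?_ (by positivity)
    refine (Finset.sum_le_sum (g := fun _ => (1 : ℝ)) fun n _ =>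
      indicator_le_self' (fun _ _ => zero_le_one) _).trans ?_
    simp

end General

/-! ### Positive frequency of visits to cylinders -/

section Cylinders

lemma measureReal_cylinder_pos (J : Finset ℤ) (η : Seq 2) :
    0 < (bernoulliMeasure 2).real {ω | ∀ j ∈ J, ω j = η j} := by
  have : {ω : Seq 2 | ∀ j ∈ J, ω j = η j} = Set.pi J fun j => {η j} := by
    ext ω; simp [Set.mem_pi]
  rw [this, measureReal_def, bernoulliMeasure, Measure.infinitePi_pi _ (by simp)]
  refine ENNReal.toReal_pos ?_ (ENNReal.prod_ne_top fun _ _ => measure_ne_top _ _)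
  refine Finset.prod_ne_zero_iff.2 fun j _ => ?_
  rw [PMF.toMeasure_apply_singleton _ _ (measurableSet_singleton _)]
  simp

/-- Almost every sequence visits every cylinder with positive frequency. -/
lemma ae_tendsto_cylinder : ∀ᵐ ω ∂bernoulliMeasure 2, ∀ (J : Finset ℤ) (η : Seq 2),
    ∃ c : ℝ, 0 < c ∧ Tendsto (fun N : ℕ => (∑ n ∈ Finset.range N,
      {ω : Seq 2 | ∀ j ∈ J, ω j = η j}.indicator (1 : Seq 2 → ℝ) (shiftBy n ω)) / N) atTop (𝓝 c) := by
  have key : ∀ (J : Finset ℤ) (η : Seq 2), ∀ᵐ ω ∂bernoulliMeasure 2,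
      ∃ c : ℝ, 0 < c ∧ Tendsto (fun N : ℕ => (∑ n ∈ Finset.range N,
        {ω : Seq 2 | ∀ j ∈ J, ω j = η j}.indicator (1 : Seq 2 → ℝ) (shiftBy n ω)) / N)
          atTop (𝓝 c) := by
    intro J η
    have hdep : DependsOn ({ω : Seq 2 | ∀ j ∈ J, ω j = η j}.indicator (1 : Seq 2 → ℝ))
        (Finset.Ico (-((J.sup Int.natAbs + 1 : ℕ) : ℤ)) ((J.sup Int.natAbs + 1 : ℕ) : ℤ) : Set ℤ) := by
      intro ω ω' h
      have : ω ∈ {ω : Seq 2 | ∀ j ∈ J, ω j = η j} ↔ ω' ∈ {ω : Seq 2 | ∀ j ∈ J, ω j = η j} := by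
        refine forall₂_congr fun j hj => ?_
        rw [h j]
        have : j.natAbs ≤ J.sup Int.natAbs := Finset.le_sup hj
        simp only [Finset.coe_Ico, mem_Ico]
        omega
      simp only [indicator, this, Pi.one_apply]
    have hms : MeasurableSet {ω : Seq 2 | ∀ j ∈ J, ω j = η j} := by
      have : {ω : Seq 2 | ∀ j ∈ J, ω j = η j} = Set.pi J fun j => {η j} := by
        ext ω; simp [Set.mem_pi]
      rw [this]
      exact MeasurableSet.pi J.countable_toSet fun _ _ => measurableSet_singleton _
    filter_upwards [ae_tendsto_average_shift hdep fun ω => by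
      simp only [indicator]; split_ifs <;> simp] with ω hω
    refine ⟨_, measureReal_cylinder_pos J η, ?_⟩
    rwa [integral_indicator_one hms] at hω
  -- There are uncountably many `η` but only countably many finite patterns, so a single null set
  -- serves all cylinders.
  have key2 : ∀ᵐ ω ∂bernoulliMeasure 2, ∀ (J : Finset ℤ) (v : J → Fin 2),
      ∃ c : ℝ, 0 < c ∧ Tendsto (fun N : ℕ => (∑ n ∈ Finset.range N,
        {ω : Seq 2 | ∀ j (hj : j ∈ J), ω j = v ⟨j, hj⟩}.indicator (1 : Seq 2 → ℝ) (shiftBy n ω)) / N)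
          atTop (𝓝 c) := by
    refine ae_all_iff.2 fun J => ae_all_iff.2 fun v => ?_
    have h := key J fun j => if hj : j ∈ J then v ⟨j, hj⟩ else 0
    have e : {ω : Seq 2 | ∀ j ∈ J, ω j = if hj : j ∈ J then v ⟨j, hj⟩ else 0}
        = {ω : Seq 2 | ∀ j (hj : j ∈ J), ω j = v ⟨j, hj⟩} := by
      ext ω
      exact forall₂_congr fun j hj => by rw [dif_pos hj]
    rwa [e] at h
  filter_upwards [key2] with ω hω J η
  exact hω J fun j => η j

end Cylinders

/-- The shift is invertible, so a preimage under the `n`-th iterate is exactly a fiber point at time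
`-n` whose orbit arrives at time `0`. -/
lemma mem_maxAttractor_iff_exists_orbit {M : Type*} (φ : Fin 2 → M → M) (p : Seq 2 × M) :
    p ∈ maxAttractor (stepSkewProduct φ) univ ↔ ∀ n : ℕ, ∃ y, orbit φ p.1 y (-n) n = p.2 := by
  simp only [maxAttractor, mem_iInter, mem_image, mem_univ, true_and, Prod.exists,
    iterate_stepSkewProduct]
  constructor
  · intro hp n
    rcases Nat.eq_zero_or_pos n with rfl | hn
    · exact ⟨p.2, rfl⟩
    · obtain ⟨ω, y, rfl⟩ := hp n hn
      exact ⟨y, by simp [orbit_shiftBy]⟩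
  · intro hp n _
    obtain ⟨y, hy⟩ := hp n
    refine ⟨shiftBy (-n) p.1, y, ?_⟩
    ext1
    · ext i; simp
    · simpa [orbit_shiftBy] using hy

/-! ### The measure on the phase space -/

section Phase

lemma segmentMeasure_apply (A : Set Segment) :
    segmentMeasure A = volume (Subtype.val '' A) :=
  (MeasurableEmbedding.subtype_coe measurableSet_Icc).comap_apply _ _

instance : IsFiniteMeasure segmentMeasure :=
  ⟨by rw [segmentMeasure_apply, image_univ, Subtype.range_coe]; simp⟩

lemma phaseMeasure_pos_ne_zero :
    phaseMeasure 2 {p | 0 < (p.2 : ℝ)} ≠ 0 := by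
  have h : {p : Seq 2 × Segment | 0 < (p.2 : ℝ)} = univ ×ˢ {x : Segment | 0 < (x : ℝ)} := by
    ext; simp
  rw [h, phaseMeasure, Measure.prod_prod, measure_univ, one_mul, segmentMeasure_apply]
  have : Subtype.val '' {x : Segment | 0 < (x : ℝ)} = Ioc (0 : ℝ) 1 := by
    ext x
    constructor
    · rintro ⟨y, hy, rfl⟩; exact ⟨hy, y.2.2⟩
    · intro hx; exact ⟨⟨x, by linarith [hx.1], hx.2⟩, hx.1, rfl⟩
  rw [this]
  simp

lemma ae_phaseMeasure_fst {P : Seq 2 → Prop} (h : ∀ᵐ ω ∂bernoulliMeasure 2, P ω) :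
    ∀ᵐ p ∂phaseMeasure 2, P p.1 :=
  Measure.quasiMeasurePreserving_fst.ae h

lemma isClosed_zeroSection (s : ℕ) : IsClosed (zeroSection s) :=
  isClosed_eq (by fun_prop) continuous_const

end Phase

/-! ### The attractors of the skew product on the whole segment -/

/-- Monotone maps of the segment `[-1, 1]` whose restrictions to both halves, after a reflection of
the left one, are described by `HalfSystem`s. -/
structure SegmentSystem (φ : Fin 2 → Segment → Segment) (gp gm : Fin 2 → ℝ → ℝ) (ε : ℝ) :
    Prop where
  right : HalfSystem gp ε
  left : HalfSystem gm ε
  cont : ∀ i, Continuous (φ i)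
  mono : ∀ i, Monotone (φ i)
  coe_of_nonneg : ∀ i (x : Segment), 0 ≤ (x : ℝ) → (φ i x : ℝ) = gp i x
  coe_of_nonpos : ∀ i (x : Segment), (x : ℝ) ≤ 0 → (φ i x : ℝ) = -gm i (-x)

namespace SegmentSystem

variable {φ : Fin 2 → Segment → Segment} {gp gm : Fin 2 → ℝ → ℝ} {ε : ℝ}
  (h : SegmentSystem φ gp gm ε)

include h

lemma orbit_of_nonneg (ω : Seq 2) {y : Segment} (hy : 0 ≤ (y : ℝ)) (m : ℤ) (n : ℕ) :
    ((orbit φ ω y m n : Segment) : ℝ) = orbit gp ω y m n := by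
  induction n with
  | zero => rfl
  | succ n ih =>
    simp only [orbit]
    rw [h.coe_of_nonneg, ih]
    rw [ih]
    exact (h.right.orbit_mem ω ⟨hy, y.2.2⟩ m n).1

lemma orbit_of_nonpos (ω : Seq 2) {y : Segment} (hy : (y : ℝ) ≤ 0) (m : ℤ) (n : ℕ) :
    ((orbit φ ω y m n : Segment) : ℝ) = -orbit gm ω (-y) m n := by
  induction n with
  | zero => simp [orbit]
  | succ n ih =>
    simp only [orbit]
    rw [h.coe_of_nonpos, ih, neg_neg]
    rw [ih, neg_nonpos]
    exact (h.left.orbit_mem ω ⟨by linarith, by linarith [y.2.1]⟩ m n).1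

lemma orbit_mono (ω : Seq 2) (m : ℤ) (n : ℕ) : Monotone fun y => orbit φ ω y m n := by
  induction n with
  | zero => exact monotone_id
  | succ n ih => exact (h.mono _).comp ih

lemma continuous_orbit (ω : Seq 2) (m : ℤ) (n : ℕ) : Continuous fun y => orbit φ ω y m n := by
  induction n with
  | zero => exact continuous_id
  | succ n ih => exact (h.cont _).comp ih

lemma orbit_le (ω : Seq 2) (y : Segment) (m : ℤ) (n : ℕ) :
    ((orbit φ ω y m n : Segment) : ℝ) ≤ orbit gp ω 1 m n := by
  rw [← h.orbit_of_nonneg ω (y := ⟨1, by norm_num⟩) zero_le_one]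
  exact h.orbit_mono ω m n y.2.2

lemma le_orbit (ω : Seq 2) (y : Segment) (m : ℤ) (n : ℕ) :
    -orbit gm ω 1 m n ≤ ((orbit φ ω y m n : Segment) : ℝ) := by
  have := h.orbit_of_nonpos ω (y := ⟨-1, by norm_num⟩) (by norm_num) m n
  rw [neg_neg] at this
  rw [← this]
  exact h.orbit_mono ω m n y.2.1

/-- The fibers of the maximal attractor are segments bounded by the pullback limits. -/
lemma mem_maxAttractor_iff (p : Seq 2 × Segment) :
    p ∈ maxAttractor (stepSkewProduct φ) univ ↔
      -pullbackLim gm p.1 ≤ p.2 ∧ (p.2 : ℝ) ≤ pullbackLim gp p.1 := by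
  rw [mem_maxAttractor_iff_exists_orbit]
  constructor
  · intro hp
    constructor
    · refine neg_le.1 (ge_of_tendsto' (h.left.tendsto_pullbackLim p.1) fun n => ?_)
      obtain ⟨y, hy⟩ := hp n
      rw [← hy]
      exact neg_le.1 (h.le_orbit _ _ _ _)
    · refine ge_of_tendsto' (h.right.tendsto_pullbackLim p.1) fun n => ?_
      obtain ⟨y, hy⟩ := hp n
      rw [← hy]
      exact h.orbit_le _ _ _ _
  · rintro ⟨h1, h2⟩ n
    have : PreconnectedSpace Segment := Subtype.preconnectedSpace isPreconnected_Icc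
    -- Intermediate value theorem: the images of `-1` and `1` bracket the point, since pullbacks
    -- decrease to their limits.
    refine mem_range_of_exists_le_of_exists_ge (h.continuous_orbit p.1 (-n) n)
      ⟨⟨-1, by norm_num⟩, ?_⟩ ⟨⟨1, by norm_num⟩, ?_⟩
    · rw [← Subtype.coe_le_coe, h.orbit_of_nonpos _ (y := ⟨-1, by norm_num⟩) (by norm_num)]
      simp only [neg_neg]
      exact (neg_le_neg ((h.left.antitone_pullback p.1).le_of_tendsto
        (h.left.tendsto_pullbackLim p.1) n)).trans h1
    · rw [← Subtype.coe_le_coe, h.orbit_of_nonneg _ (y := ⟨1, by norm_num⟩) (by norm_num)]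
      exact h2.trans ((h.right.antitone_pullback p.1).le_of_tendsto
        (h.right.tendsto_pullbackLim p.1) n)

lemma continuous_stepSkewProduct : Continuous (stepSkewProduct φ) := by
  refine Continuous.prodMk (by unfold shift; fun_prop) ?_
  have : Continuous fun q : Fin 2 × Segment => φ q.1 q.2 :=
    continuous_prod_of_discrete_left.2 h.cont
  exact this.comp (by fun_prop : Continuous fun p : Seq 2 × Segment => (p.1 0, p.2))

lemma isClosed_maxAttractor : IsClosed (maxAttractor (stepSkewProduct φ) univ) :=
  isClosed_iInter fun n => isClosed_iInter fun _ =>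
    (isCompact_univ.image (h.continuous_stepSkewProduct.iterate n)).isClosed

lemma fiberOver_maxAttractor (ω : Seq 2) :
    ∃ a b : Segment, (a : ℝ) = -pullbackLim gm ω ∧ (b : ℝ) = pullbackLim gp ω ∧
      fiberOver (maxAttractor (stepSkewProduct φ) univ) ω = Icc a b := by
  have h1 := h.left.pullbackLim_mem ω
  have h2 := h.right.pullbackLim_mem ω
  refine ⟨⟨-pullbackLim gm ω, by linarith [h1.2], by linarith [h1.1]⟩,
    ⟨pullbackLim gp ω, by linarith [h2.1], h2.2⟩, rfl, rfl, ?_⟩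
  ext x
  exact h.mem_maxAttractor_iff (ω, x)

lemma ae_fiberOver_maxAttractor : ∀ᵐ ω ∂bernoulliMeasure 2,
    ∃ x, fiberOver (maxAttractor (stepSkewProduct φ) univ) ω = {x} := by
  filter_upwards [h.right.ae_pullbackLim_eq_zero, h.left.ae_pullbackLim_eq_zero] with ω h1 h2
  obtain ⟨a, b, ha, hb, hab⟩ := h.fiberOver_maxAttractor ω
  have : a = b := Subtype.ext (by rw [ha, hb, h1, h2, neg_zero])
  exact ⟨b, by rw [hab, this, Icc_self]⟩

lemma isBonyGraph_maxAttractor :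
    IsBonyGraph (bernoulliMeasure 2) (maxAttractor (stepSkewProduct φ) univ) := by
  refine ⟨h.isClosed_maxAttractor, h.ae_fiberOver_maxAttractor, fun ω hω => ?_⟩
  obtain ⟨a, b, ha, hb, hab⟩ := h.fiberOver_maxAttractor ω
  have hle : a ≤ b := by
    rw [← Subtype.coe_le_coe, ha, hb]
    linarith [(h.left.pullbackLim_mem ω).1, (h.right.pullbackLim_mem ω).1]
  refine ⟨a, b, lt_of_le_of_ne hle fun e => hω ⟨b, ?_⟩, hab⟩
  rw [hab, e, Icc_self]

lemma maxAttractor_eq_union : maxAttractor (stepSkewProduct φ) univ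
    = zeroSection 2 ∪ bones (maxAttractor (stepSkewProduct φ) univ) := by
  have hzero : ∀ p : Seq 2 × Segment, (p.2 : ℝ) = 0 →
      p ∈ maxAttractor (stepSkewProduct φ) univ := fun p hp => by
    rw [h.mem_maxAttractor_iff, hp]
    exact ⟨by linarith [(h.left.pullbackLim_mem p.1).1], (h.right.pullbackLim_mem p.1).1⟩
  refine Subset.antisymm (fun p hp => ?_) (union_subset hzero fun p hp => hp.1)
  by_cases h0 : (p.2 : ℝ) = 0
  · exact Or.inl h0
  -- The fiber always contains `0`, so a nonzero point makes it nontrivial.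
  · refine Or.inr ⟨hp, p.2, hp, ⟨0, by norm_num⟩, hzero _ rfl, fun e => h0 ?_⟩
    rw [e]

lemma phaseMeasure_bones :
    phaseMeasure 2 (bones (maxAttractor (stepSkewProduct φ) univ)) = 0 := by
  refine measure_mono_null (fun p hp => ?_)
    (ae_iff.1 (ae_phaseMeasure_fst h.ae_fiberOver_maxAttractor))
  rintro ⟨x, hx⟩
  have := hp.2
  rw [hx] at this
  exact not_nontrivial_singleton this

/-- The thresholds `1 / (k + 1)` are countable and arbitrarily small, so one null set serves all
neighborhoods of the zero section. -/
lemma ae_tendsto_frequency_zero : ∀ᵐ ω ∂bernoulliMeasure 2, ∀ k : ℕ, Tendsto (fun N : ℕ =>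
    (∑ n ∈ Finset.range N, ((Ici (1 / ((k : ℝ) + 1))).indicator 1 (orbit gp ω 1 0 n)
      + (Ici (1 / ((k : ℝ) + 1))).indicator 1 (orbit gm ω 1 0 n))) / (N : ℝ)) atTop (𝓝 0) := by
  refine ae_all_iff.2 fun k => ?_
  have hk : 0 < 1 / ((k : ℝ) + 1) := by positivity
  filter_upwards [h.right.ae_tendsto_frequency_zero hk, h.left.ae_tendsto_frequency_zero hk]
    with ω h1 h2
  simpa [Finset.sum_add_distrib, add_div] using h1.add h2

/-- Every orbit is squeezed between the orbits of `-1` and `1`, so it can be far from `0` only when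
one of these is. -/
lemma indicator_le (ω : Seq 2) (x : Segment) (δ : ℝ) (n : ℕ) :
    (if δ ≤ |((orbit φ ω x 0 n : Segment) : ℝ)| then (1 : ℝ) else 0)
      ≤ (Ici δ).indicator 1 (orbit gp ω 1 0 n) + (Ici δ).indicator 1 (orbit gm ω 1 0 n) := by
  have h1 : (0 : ℝ) ≤ (Ici δ).indicator 1 (orbit gp ω 1 0 n) :=
    indicator_nonneg (fun _ _ => zero_le_one) _
  have h2 : (0 : ℝ) ≤ (Ici δ).indicator 1 (orbit gm ω 1 0 n) :=
    indicator_nonneg (fun _ _ => zero_le_one) _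
  split_ifs with hδ
  · rcases le_abs.1 hδ with hp | hm
    · rw [indicator_of_mem (mem_Ici.2 (hp.trans (h.orbit_le ω x 0 n))), Pi.one_apply]
      linarith
    · rw [indicator_of_mem (mem_Ici.2 (hm.trans (neg_le.1 (h.le_orbit ω x 0 n)))), Pi.one_apply]
      linarith
  · linarith

lemma ae_omegaStat_eq :
    ∀ᵐ p ∂phaseMeasure 2, omegaStat (stepSkewProduct φ) p = zeroSection 2 := by
  filter_upwards [ae_phaseMeasure_fst h.ae_tendsto_frequency_zero,
    ae_phaseMeasure_fst ae_tendsto_cylinder] with p h0 hcyl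
  obtain ⟨ω, x⟩ := p
  simp only at h0 hcyl
  refine Subset.antisymm (fun z hz => ?_) (fun z hz U hU => ?_)
  · by_contra hne
    obtain ⟨k, hk⟩ := exists_nat_one_div_lt (abs_pos.2 hne)
    have hopen : IsOpen {q : Seq 2 × Segment | 1 / ((k : ℝ) + 1) < |(q.2 : ℝ)|} :=
      isOpen_lt continuous_const (by fun_prop)
    refine (hz _ (hopen.mem_nhds hk)).ne' (freq_eq_zero (fun n => ?_) (h0 k))
    refine le_trans ?_ (h.indicator_le ω x _ n)
    rw [iterate_stepSkewProduct]
    simp only [indicator, mem_ofPred_eq, Pi.one_apply]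
    split_ifs with h1 h2 h2
    · rfl
    · exact absurd h1.le h2
    · exact zero_le_one
    · rfl
  · obtain ⟨η, z⟩ := z
    obtain ⟨u, hu, v, hv, huv⟩ := mem_nhds_prod_iff.1 hU
    rw [nhds_pi, Filter.mem_pi] at hu
    obtain ⟨I, hI, t, ht, hIt⟩ := hu
    obtain ⟨δ, hδ, hball⟩ := Metric.mem_nhds_iff.1 hv
    obtain ⟨k, hk⟩ := exists_nat_one_div_lt hδ
    obtain ⟨c, hc, hlim⟩ := hcyl hI.toFinset η
    -- A visit to the cylinder while the fiber coordinate is small is a visit to `U`; the frequency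
    -- of `U` is thus at least that of the cylinder minus that of being far from `0`, which is `c -
    -- 0`.
    have hlim2 := hlim.sub (h0 k)
    rw [sub_zero] at hlim2
    refine hc.trans_le (le_freq (fun n => ?_) (hlim2.congr fun N => by
      rw [← sub_div, ← Finset.sum_sub_distrib]))
    have h1 := h.indicator_le ω x (1 / ((k : ℝ) + 1)) n
    have h2 : (0 : ℝ) ≤ U.indicator 1 ((stepSkewProduct φ)^[n] (ω, x)) :=
      indicator_nonneg (fun _ _ => zero_le_one) _
    by_cases hcy : shiftBy n ω ∈ {ω : Seq 2 | ∀ j ∈ hI.toFinset, ω j = η j}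
    · rw [indicator_of_mem hcy, Pi.one_apply]
      split_ifs at h1 with h3
      · linarith
      · have : (stepSkewProduct φ)^[n] (ω, x) ∈ U := by
          rw [iterate_stepSkewProduct]
          refine huv ⟨hIt fun i hi => ?_, hball ?_⟩
          · have := hcy i (hI.mem_toFinset.2 hi)
            simp only [this]
            exact mem_of_mem_nhds (ht i)
          · have hz0 : (z : ℝ) = 0 := hz
            rw [Metric.mem_ball, Subtype.dist_eq, hz0, Real.dist_eq, sub_zero]
            exact (not_le.1 h3).trans hk
        rw [indicator_of_mem this, Pi.one_apply]
        linarith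
    · rw [indicator_of_notMem hcy]
      split_ifs at h1 <;> linarith

lemma isStatisticalAttractor_zeroSection :
    IsStatisticalAttractor (stepSkewProduct φ) (phaseMeasure 2) (zeroSection 2) := by
  refine ⟨⟨isClosed_zeroSection 2, ?_⟩, ?_⟩
  · filter_upwards [h.ae_omegaStat_eq] with p hp
    exact hp.subset
  · rintro K ⟨-, hK⟩
    have : NeZero (phaseMeasure 2) :=
      ⟨fun e => phaseMeasure_pos_ne_zero (by rw [e]; rfl)⟩
    -- Typical statistical limit sets equal the whole zero section, so one typical point already
    -- forces it into `K`.
    obtain ⟨p, hp, hpK⟩ := (h.ae_omegaStat_eq.and hK).exists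
    rwa [hp] at hpK

/-- Orbits from the positive half, a set of positive measure, return infinitely often to the compact
set of height at least `ε`, hence accumulate there. -/
lemma not_ae_omegaLim_subset :
    ¬ ∀ᵐ p ∂phaseMeasure 2, omegaLim (stepSkewProduct φ) p ⊆ zeroSection 2 := by
  intro hsub
  refine phaseMeasure_pos_ne_zero ?_
  have hae : ∀ᵐ p ∂phaseMeasure 2, ¬ 0 < (p.2 : ℝ) := by
    filter_upwards [hsub, ae_phaseMeasure_fst h.right.ae_frequently_ge] with p hp hfreq hpos
    have hclosed : IsClosed {q : Seq 2 × Segment | ε ≤ (q.2 : ℝ)} :=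
      isClosed_le continuous_const (by fun_prop)
    obtain ⟨z, hz, hcl⟩ := hclosed.isCompact.exists_mapClusterPt_of_frequently
      (l := atTop) (f := fun n : ℕ => (stepSkewProduct φ)^[n] p)
      ((hfreq p.2 hpos).mono fun n hn => by
        rw [← h.orbit_of_nonneg _ hpos.le] at hn
        have := iterate_stepSkewProduct φ p.1 p.2 n
        rw [show (stepSkewProduct φ)^[n] p = _ from this]
        exact hn)
    have hz0 : (z.2 : ℝ) = 0 := hp ((mem_omegaLimit_singleton_iff_mapClusterPt _ _ _ _).2 hcl)
    have : ε ≤ (z.2 : ℝ) := hz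
    linarith [h.right.eps_pos]
  simpa [ae_iff] using hae

end SegmentSystem

/-! ### From the given diffeomorphisms to half systems -/

/-- The extension of maps of `[0, 1]` to the line by constants. -/
def extendUnit (f : Fin 2 → ℝ → ℝ) (i : Fin 2) : ℝ → ℝ :=
  IccExtend zero_le_one ((Icc (0 : ℝ) 1).domRestrict (f i))

lemma extendUnit_of_mem (f : Fin 2 → ℝ → ℝ) (i : Fin 2) {x : ℝ} (hx : x ∈ Icc (0 : ℝ) 1) :
    extendUnit f i x = f i x := IccExtend_of_mem _ _ hx

/-- A pair of increasing maps of `[0, 1]` extends to a `HalfSystem`. -/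
lemma HalfSystem.of_Icc {f : Fin 2 → ℝ → ℝ} {ε : ℝ} (hε0 : 0 < ε) (hε1 : ε ≤ 1)
    (hcont : ∀ i, ContinuousOn (f i) (Icc 0 1)) (hmono : ∀ i, MonotoneOn (f i) (Icc 0 1))
    (hzero : ∀ i, f i 0 = 0) (hlt : ∀ i, f i 1 < 1)
    (hfix : ∀ x ∈ Icc (0 : ℝ) 1, f 0 x = x → x = 0)
    (h0 : ∀ x, 0 ≤ x → x ≤ ε → f 0 x = x / 2) (h1 : ∀ x, 0 ≤ x → x ≤ ε → f 1 x = 2 * x) :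
    HalfSystem (extendUnit f) ε := by
  have hext := fun i x hx => extendUnit_of_mem f i (x := x) hx
  refine ⟨hε0, hε1, fun i => (hcont i).domRestrict.Icc_extend',
    fun i => Monotone.IccExtend _ fun x y hxy => hmono i x.2 y.2 hxy, fun i => ?_, fun i => ?_,
    fun x hx hx1 => ?_, fun x hx hxe => ?_, fun x hx hxe => ?_⟩
  · rw [hext i 0 (by simp), hzero]
  · rw [hext i 1 (by simp)]; exact (hlt i).le
  · rw [hext 0 x ⟨hx.le, hx1⟩]
    -- If `x ≤ f 0 x`, then `f 0 1 < 1` and the intermediate value theorem give a fixed point in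
    -- `[x, 1]`, which is nonzero.
    by_contra! hc
    have hivt := intermediate_value_Icc' hx1
      ((((hcont 0).mono (Icc_subset_Icc_left hx.le)).sub continuousOn_id))
    obtain ⟨y, hy, hy0⟩ := hivt (show (0 : ℝ) ∈ _ from
      ⟨by simpa using (hlt 0).le, by simpa using hc⟩)
    have := hfix y ⟨hx.le.trans hy.1, hy.2⟩ (sub_eq_zero.1 hy0)
    linarith [hy.1]
  · rw [hext 0 x ⟨hx, hxe.trans hε1⟩, h0 x hx hxe]
  · rw [hext 1 x ⟨hx, hxe.trans hε1⟩, h1 x hx hxe]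

/-- The slope of a linear germ is its derivative. -/
lemma slope_eq_of_hasDerivAt {f : ℝ → ℝ} {ε c d : ℝ} (hε : 0 < ε)
    (hf : ∀ x ∈ Icc (-ε) ε, f x = c * x) (hd : HasDerivAt f d 0) : c = d := by
  refine HasDerivAt.unique (((hasDerivAt_id (0 : ℝ)).const_mul c).congr_of_eventuallyEq ?_) hd
    |> fun h => by simpa using h
  filter_upwards [Icc_mem_nhds (neg_lt_zero.2 hε) hε] with x hx
  exact hf x hx

end SSP

end

theorem lemma3p6
    -- `f 0` and `f 1` are the two fiber maps `f₁` and `f₂`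
    (f : Fin 2 → ℝ → ℝ)
    -- they are orientation preserving diffeomorphisms of `[-1, 1]` onto their images
    (hsmooth : ∀ i, ContDiffOn ℝ 1 (f i) (Icc (-1) 1))
    (hderiv : ∀ i, ∀ x ∈ Icc (-1 : ℝ) 1, 0 < derivWithin (f i) (Icc (-1) 1) x)
    -- they send `[-1, 1]` strictly inside itself
    (hmaps : ∀ i, MapsTo (f i) (Icc (-1) 1) (Ioo (-1) 1))
    (hfix : ∀ x ∈ Icc (-1 : ℝ) 1, f 0 x = x → x = 0)
    (hzero : ∀ i, f i 0 = 0)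
    (hd1 : HasDerivAt (f 0) (1 / 2) 0)
    (hd2 : HasDerivAt (f 1) 2 0)
    (ε : ℝ) (hε0 : 0 < ε) (hε1 : ε ≤ 1)
    (hlin : ∀ i, ∃ c : ℝ, ∀ x ∈ Icc (-ε) ε, f i x = c * x)
    (F : SSP.Seq 2 × SSP.Segment → SSP.Seq 2 × SSP.Segment)
    (hF : F = SSP.stepSkewProduct
      (fun i => ((hmaps i).mono_right Ioo_subset_Icc_self).restrict)) :
    (SSP.IsBonyGraph (SSP.bernoulliMeasure 2) (SSP.maxAttractor F univ) ∧
      SSP.maxAttractor F univ = SSP.zeroSection 2 ∪ SSP.bones (SSP.maxAttractor F univ) ∧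
      SSP.phaseMeasure 2 (SSP.bones (SSP.maxAttractor F univ)) = 0) ∧
    (SSP.IsStatisticalAttractor F (SSP.phaseMeasure 2) (closure (SSP.zeroSection 2)) ∧
      closure (SSP.zeroSection 2) = SSP.zeroSection 2) ∧
    ∃ A : Set (SSP.Seq 2 × SSP.Segment),
      SSP.IsMilnorAttractor F (SSP.phaseMeasure 2) A ∧ A ≠ closure (SSP.zeroSection 2) := by
  have hcont : ∀ i, ContinuousOn (f i) (Icc (-1) 1) := fun i => (hsmooth i).continuousOn
  have hmono : ∀ i, MonotoneOn (f i) (Icc (-1) 1) := fun i => by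
    refine (strictMonoOn_of_deriv_pos (convex_Icc _ _) (hcont i) fun x hx => ?_).monotoneOn
    rw [interior_Icc] at hx
    rw [← derivWithin_of_mem_nhds (Icc_mem_nhds hx.1 hx.2)]
    exact hderiv i x (Ioo_subset_Icc_self hx)
  have hlin0 : ∀ x ∈ Icc (-ε) ε, f 0 x = x / 2 := fun x hx => by
    obtain ⟨c, hc⟩ := hlin 0
    rw [hc x hx, SSP.slope_eq_of_hasDerivAt hε0 hc hd1]
    ring
  have hlin1 : ∀ x ∈ Icc (-ε) ε, f 1 x = 2 * x := fun x hx => by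
    obtain ⟨c, hc⟩ := hlin 1
    rw [hc x hx, SSP.slope_eq_of_hasDerivAt hε0 hc hd2]
  have hR : Icc (0 : ℝ) 1 ⊆ Icc (-1) 1 := Icc_subset_Icc_left (by norm_num)
  have hL : MapsTo (fun x : ℝ => -x) (Icc 0 1) (Icc (-1) 1) := fun x hx =>
    ⟨by linarith [hx.2], by linarith [hx.1]⟩
  have hp := SSP.HalfSystem.of_Icc hε0 hε1 (fun i => (hcont i).mono hR)
    (fun i => (hmono i).mono hR) hzero (fun i => (hmaps i (by simp)).2)
    (fun x hx => hfix x (hR hx)) (fun x h1 h2 => hlin0 x ⟨by linarith, h2⟩)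
    (fun x h1 h2 => hlin1 x ⟨by linarith, h2⟩)
  -- The left half is conjugated to the right one by the reflection of the fiber.
  have hm := SSP.HalfSystem.of_Icc (f := fun i x => -f i (-x)) hε0 hε1
    (fun i => ((hcont i).comp continuousOn_neg hL).neg)
    (fun i x hx y hy hxy => neg_le_neg (hmono i (hL hy) (hL hx) (neg_le_neg hxy)))
    (fun i => by simp [hzero]) (fun i => by linarith [(hmaps i (x := -1) (by simp)).1])
    (fun x hx h => neg_eq_zero.1 (hfix (-x) (hL hx) (by linarith)))
    (fun x h1 h2 => by rw [hlin0 (-x) ⟨by linarith, by linarith⟩]; ring)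
    (fun x h1 h2 => by rw [hlin1 (-x) ⟨by linarith, by linarith⟩]; ring)
  have h : SSP.SegmentSystem (fun i => ((hmaps i).mono_right Ioo_subset_Icc_self).restrict)
      (SSP.extendUnit f) (SSP.extendUnit fun i x => -f i (-x)) ε := by
    refine ⟨hp, hm, fun i => (hcont i).mapsToRestrict _, fun i x y hxy => hmono i x.2 y.2 hxy,
      fun i x hx => ?_, fun i x hx => ?_⟩
    · exact (SSP.extendUnit_of_mem f i ⟨hx, x.2.2⟩).symm
    · rw [SSP.extendUnit_of_mem _ _ (show -(x : ℝ) ∈ Icc (0 : ℝ) 1 from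
        ⟨by linarith, by linarith [x.2.1]⟩)]
      simp only [neg_neg]
      rfl
  rw [(SSP.isClosed_zeroSection 2).closure_eq, hF]
  refine ⟨⟨h.isBonyGraph_maxAttractor, h.maxAttractor_eq_union, h.phaseMeasure_bones⟩,
    ⟨h.isStatisticalAttractor_zeroSection, rfl⟩, ?_⟩
  obtain ⟨A, hA⟩ := SSP.exists_isLeast_isClosed_ae_subset (SSP.phaseMeasure 2)
    (SSP.omegaLim (SSP.stepSkewProduct
      (fun i => ((hmaps i).mono_right Ioo_subset_Icc_self).restrict)))
  exact ⟨A, hA, fun e => h.not_ae_omegaLim_subset (e ▸ hA.1.2)⟩
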